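/- Let $X$ be a complex Banach space and let $J=\mathbb R$ or $J=\mathbb R_+=[0,\infty)$. For $F\in L^1_{loc}(J,X)$ let $\overline F:\mathbb R\to X$ be the extension of $F$ by $0$, let $\mathcal D(\mathbb R)$ be the space of complex-valued smooth functions with compact support on $\mathbb R$, and for $\varphi\in\mathcal D(\mathbb R)$ put $\widehat\varphi(\omega)=\int_{\mathbb R}e^{-i\omega t}\varphi(t)\,dt$ and $(\overline F*\varphi)(t)=\int_{\mathbb R}\overline F(t-s)\varphi(s)\,ds$. Let $C_0(J,X)$ be the space of continuous functions $J\to X$ vanishing at infinity. The reduced Beurling spectrum of $F$ relative to $(C_0(J,X),\mathcal D)$ is $$sp_{C_0(J,X),\mathcal D}(F)=\{\omega\in\mathbb R:\ \widehat\varphi(\omega)=0\ \text{for every}\ \varphi\in\mathcal D(\mathbb R)\ \text{with}\ (\overline F*\varphi)|_J\in C_0(J,X)\}.$$ (1) Let $F\in L^1_{loc}(J,X)$ with $sp_{C_0(J,X),\mathcal D}(F)=\emptyset$. If $\psi\in\mathcal D(\mathbb R)$ is such that $(\overline F*\psi)|_J$ is uniformly continuous, then $\overline F*\psi\in C_0(\mathbb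 R,X)$. (2) This applies to every $F\in L^p(J,X)$ with $1\le p<\infty$: then $F\in L^1_{loc}(J,X)$, $sp_{C_0(J,X),\mathcal D}(F)=\emptyset$, and $(\overline F*\psi)|_J$ is uniformly continuous for every $\psi\in\mathcal D(\mathbb R)$. (3) If $X\neq\{0\}$ and $2<p<\infty$, there is $F\in L^p(J,X)$ such that the Fourier transform of $\overline F$, that is the distribution $\varphi\mapsto\int_{\mathbb R}\widehat\varphi(s)\overline F(s)\,ds$, is not regular: there is no $H\in L^1_{loc}(\mathbb R,X)$ with $\int_{\mathbb R}\widehat\varphi\,\overline F=\int_{\mathbb R}\varphi H$ for all $\varphi\in\mathcal D(\mathbb R)$. -/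

import Mathlib

open MeasureTheory
open scoped ENNReal Convolution Distributions ZeroAtInfty

noncomputable section

namespace ReducedSpectrum

/-- The space `𝓓(ℝ)` of complex-valued smooth functions on `ℝ` with compact support. -/
abbrev TestFn : Type := 𝓓((⊤ : TopologicalSpace.Opens ℝ), ℂ)

/-- The Fourier transform `φ̂(ω) = ∫ e^{-iωt} φ(t) dt`. -/
def hat (φ : ℝ → ℂ) (ω : ℝ) : ℂ :=
  ∫ t : ℝ, Complex.exp (-(Complex.I * ω * t)) * φ t

variable {X : Type*} [NormedAddCommGroup X] [NormedSpace ℂ X]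

/-- `F̄ * φ`, that is `t ↦ ∫ φ(s) F̄(t - s) ds`, where `F̄` is the extension by zero to `ℝ` of a
function `F` on `J`. A function on `J` is represented by a function on `ℝ` whose values
outside `J` are ignored. -/
def extConv (J : Set ℝ) (F : ℝ → X) (φ : ℝ → ℂ) : ℝ → X :=
  φ ⋆[ContinuousLinearMap.lsmul ℂ ℂ, volume] J.indicator F

/-- The reduced Beurling spectrum `sp_{𝒜,V}(F)` of a function `F` on `J`, relative to a set `𝒜` of
functions on `J` and a set `V` of functions on `ℝ`. -/
def reducedSpectrum (J : Set ℝ) (𝒜 : Set (J → X)) (V : Set (ℝ → ℂ)) (F : ℝ → X) : Set ℝ :=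
  {ω | ∀ φ ∈ V, J.domRestrict (extConv J F φ) ∈ 𝒜 → hat φ ω = 0}

/-- The space `C₀(J, X)` as a set of functions on `J`. -/
def C0 (J : Set ℝ) (X : Type*) [NormedAddCommGroup X] : Set (J → X) :=
  Set.range (fun g : C₀(J, X) => (g : J → X))

/-- The space `𝓓(ℝ)` as a set of functions on `ℝ`. -/
def testFns : Set (ℝ → ℂ) :=
  Set.range (fun φ : TestFn => (φ : ℝ → ℂ))

/-- The Fourier transform `φ ↦ ∫ φ̂(s) G(s) ds` of `G` is a regular distribution: it is given on
test functions by integration against a locally integrable function. (For `G ∈ Lᵖ` the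
integrals exist because `φ̂` is rapidly decreasing.) -/
def FourierIsRegular (G : ℝ → X) : Prop :=
  ∃ H : ℝ → X, LocallyIntegrable H volume ∧
    ∀ φ : TestFn, ∫ s : ℝ, hat φ s • G s = ∫ s : ℝ, φ s • H s

end ReducedSpectrum

end

/-
(1) The test functions `φ` with `F̄ * φ ∈ C₀(ℝ, X)` form an ideal for convolution, and the spectral
hypothesis says that their Fourier transforms have no common zero. On a compact set of frequencies
finitely many of them, combined as `∑ conj φᵢ(-·) * φᵢ`, give an element of the ideal with positive
Fourier transform; dividing by it puts every band-limited kernel `ρ` into the ideal up to an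
integrable factor, whence `ρ * F̄ * ψ ∈ C₀(ℝ, X)`. A uniformly continuous `F̄ * ψ` is a uniform
limit of such functions.

(2) By Hölder, `u ↦ φ * u` is bounded from `Lᵖ` to the bounded functions, and it maps the dense
subspace of compactly supported functions into `C₀`.

(3) The chirps `exp (π i r t²) b(t)` have constant modulus, hence constant energy, but their Fourier
transforms tend to `0` uniformly as `r → ∞`. By interpolation these transforms tend to `0` in `Lᵖ`
for `p > 2`, so by uniform boundedness and duality, integration against them is unbounded on some
`F ∈ Lᵖ`, whereas a regular distribution is bounded on functions dominated by `|b|`.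
-/

namespace ReducedSpectrum

open Filter Topology ContinuousLinearMap
open scoped FourierTransform SchwartzMap ContDiff ComplexOrder

section Convolution

theorem locallyIntegrable_norm {V E : Type*} [TopologicalSpace V] [MeasurableSpace V]
    [NormedAddCommGroup E] {μ : Measure V} {k : V → E} (hk : LocallyIntegrable k μ) :
    LocallyIntegrable (fun t => ‖k t‖) μ := fun x => (hk x).imp fun _ h => ⟨h.1, h.2.norm⟩

variable {X : Type*} [NormedAddCommGroup X] [NormedSpace ℂ X]
variable {V : Type*} [NormedAddCommGroup V] [MeasurableSpace V] [BorelSpace V] {μ : Measure V}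

theorem tendsto_convolution_cocompact [ProperSpace V] {h : V → ℂ} (hh : Integrable h μ)
    {g : V → X} (hg : Continuous g) (hg0 : Tendsto g (cocompact V) (𝓝 0)) :
    Tendsto (h ⋆[lsmul ℂ ℂ, μ] g) (cocompact V) (𝓝 0) := by
  obtain ⟨C, hC⟩ : ∃ C, ∀ x, ‖g x‖ ≤ C := by
    let g₀ : C₀(V, X) := ⟨⟨g, hg⟩, hg0⟩
    exact ⟨‖g₀.toBCF‖, g₀.toBCF.norm_coe_le_norm⟩
  have : (cocompact V).IsCountablyGenerated := by
    rw [← Metric.cobounded_eq_cocompact, ← comap_norm_atTop]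
    infer_instance
  have hlim : Tendsto (fun x => ∫ t, h t • g (x - t) ∂μ) (cocompact V) (𝓝 (∫ _, (0 : X) ∂μ)) := by
    refine tendsto_integral_filter_of_dominated_convergence (fun t => ‖h t‖ * C)
      (.of_forall fun x => ?_) (.of_forall fun x => .of_forall fun t => ?_)
      (hh.norm.mul_const C) (.of_forall fun t => ?_)
    · exact hh.aestronglyMeasurable.smul (hg.comp (continuous_sub_left x)).aestronglyMeasurable
    · rw [norm_smul]
      gcongr
      exact hC _
    · have := hg0.comp (Homeomorph.subRight t).isClosedEmbedding.tendsto_cocompact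
      simpa using this.const_smul (h t)
  rwa [integral_zero] at hlim

theorem convolution_lsmul_comm [μ.IsAddLeftInvariant] [μ.IsNegInvariant]
    (f g : V → ℂ) : f ⋆[lsmul ℂ ℂ, μ] g = g ⋆[lsmul ℂ ℂ, μ] f := by
  funext x
  rw [convolution_eq_swap, convolution_def]
  simp only [lsmul_apply, smul_eq_mul, mul_comm]

section Assoc

variable [CompleteSpace X] [SecondCountableTopology V] [IsLocallyFiniteMeasure μ]
  [μ.IsAddLeftInvariant] [μ.IsNegInvariant]

theorem convolution_assoc_of_hasCompactSupport {f φ : V → ℂ} {k : V → X} (hf : Integrable f μ)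
    (hφ : Continuous φ) (hφc : HasCompactSupport φ) (hk : LocallyIntegrable k μ) {x : V}
    (hx : ConvolutionExistsAt (fun t => ‖f t‖)
      ((fun s => ‖φ s‖) ⋆[mul ℝ ℝ, μ] fun s => ‖k s‖) x (mul ℝ ℝ) μ) :
    ((f ⋆[lsmul ℂ ℂ, μ] φ) ⋆[lsmul ℂ ℂ, μ] k) x =
      (f ⋆[lsmul ℂ ℂ, μ] (φ ⋆[lsmul ℂ ℂ, μ] k)) x :=
  convolution_assoc (lsmul ℂ ℂ) (lsmul ℂ ℂ) (lsmul ℂ ℂ) (lsmul ℂ ℂ) (fun a b z => smul_assoc a b z)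
    hf.aestronglyMeasurable hφ.aestronglyMeasurable hk.aestronglyMeasurable
    (.of_forall (hφc.convolutionExists_right (lsmul ℂ ℂ) hf.locallyIntegrable hφ))
    (.of_forall (hφc.norm.convolutionExists_left (mul ℝ ℝ) hφ.norm (locallyIntegrable_norm hk))) hx

theorem convolution_assoc_of_hasCompactSupport_left {η φ : V → ℂ}
    {k : V → X} (hη : Continuous η) (hηc : HasCompactSupport η) (hφ : Continuous φ)
    (hφc : HasCompactSupport φ) (hk : LocallyIntegrable k μ) :
    (η ⋆[lsmul ℂ ℂ, μ] φ) ⋆[lsmul ℂ ℂ, μ] k = η ⋆[lsmul ℂ ℂ, μ] (φ ⋆[lsmul ℂ ℂ, μ] k) := by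
  have hφk : Continuous ((fun s => ‖φ s‖) ⋆[mul ℝ ℝ, μ] fun s => ‖k s‖) :=
    hφc.norm.continuous_convolution_left (mul ℝ ℝ) hφ.norm (locallyIntegrable_norm hk)
  exact funext fun x => convolution_assoc_of_hasCompactSupport
    (hη.integrable_of_hasCompactSupport hηc) hφ hφc hk
    (hηc.norm.convolutionExists_left (mul ℝ ℝ) hη.norm hφk.locallyIntegrable x)

theorem convolution_left_comm {η φ : V → ℂ} {k : V → X}
    (hη : Continuous η) (hηc : HasCompactSupport η) (hφ : Continuous φ)
    (hφc : HasCompactSupport φ) (hk : LocallyIntegrable k μ) :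
    η ⋆[lsmul ℂ ℂ, μ] (φ ⋆[lsmul ℂ ℂ, μ] k) = φ ⋆[lsmul ℂ ℂ, μ] (η ⋆[lsmul ℂ ℂ, μ] k) := by
  rw [← convolution_assoc_of_hasCompactSupport_left hη hηc hφ hφc hk, convolution_lsmul_comm,
    convolution_assoc_of_hasCompactSupport_left hφ hφc hη hηc hk]

end Assoc

end Convolution

section LinearGrowth

variable {V E E' X : Type*} [NormedAddCommGroup V] [NormedAddCommGroup E] [NormedAddCommGroup E']
  [NormedAddCommGroup X] [NormedSpace ℂ X] {C : ℝ}

theorem norm_mul_norm_sub_le_of_linear_growth {f : V → E} {k : V → E'} (hC : 0 ≤ C)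
    (hkC : ∀ t, ‖k t‖ ≤ C * (1 + ‖t‖)) (x t : V) :
    ‖f t‖ * ‖k (x - t)‖ ≤ C * (1 + ‖x‖) * (‖f t‖ + ‖t‖ * ‖f t‖) := by
  have hweight : 1 + ‖x - t‖ ≤ (1 + ‖x‖) * (1 + ‖t‖) := by
    nlinarith [norm_sub_le x t, mul_nonneg (norm_nonneg x) (norm_nonneg t)]
  calc ‖f t‖ * ‖k (x - t)‖ ≤ ‖f t‖ * (C * ((1 + ‖x‖) * (1 + ‖t‖))) := by
        gcongr
        exact (hkC _).trans (by gcongr)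
    _ = C * (1 + ‖x‖) * (‖f t‖ + ‖t‖ * ‖f t‖) := by ring

variable [MeasurableSpace V] {μ : Measure V}

theorem norm_convolution_norm_le_of_linear_growth {f : V → E} {k : V → E'}
    (hf : Integrable f μ) (hf₁ : Integrable (fun t => ‖t‖ * ‖f t‖) μ) (hC : 0 ≤ C)
    (hkC : ∀ t, ‖k t‖ ≤ C * (1 + ‖t‖)) (x : V) :
    ‖((fun s => ‖f s‖) ⋆[mul ℝ ℝ, μ] fun s => ‖k s‖) x‖ ≤
      C * (∫ t, ‖f t‖ + ‖t‖ * ‖f t‖ ∂μ) * (1 + ‖x‖) := by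
  rw [convolution_mul, mul_right_comm, ← integral_const_mul]
  refine norm_integral_le_of_norm_le ((hf.norm.add hf₁).const_mul _) (.of_forall fun t => ?_)
  rw [Real.norm_of_nonneg (by positivity)]
  exact norm_mul_norm_sub_le_of_linear_growth hC hkC x t

theorem convolutionExistsAt_norm_of_linear_growth [BorelSpace V]
    {f : V → E} {k : V → ℝ} (hf : Integrable f μ) (hf₁ : Integrable (fun t => ‖t‖ * ‖f t‖) μ)
    (hk : Continuous k) (hC : 0 ≤ C) (hkC : ∀ t, ‖k t‖ ≤ C * (1 + ‖t‖)) (x : V) :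
    ConvolutionExistsAt (fun t => ‖f t‖) k x (mul ℝ ℝ) μ := by
  refine ((hf.norm.add hf₁).const_mul (C * (1 + ‖x‖))).mono' ?_ (.of_forall fun t => ?_)
  · exact hf.norm.aestronglyMeasurable.mul
      (hk.comp (continuous_sub_left x)).aestronglyMeasurable
  · rw [mul_apply', norm_mul, norm_norm]
    exact norm_mul_norm_sub_le_of_linear_growth hC hkC x t

theorem convolution_assoc_of_linear_growth [CompleteSpace X] [BorelSpace V]
    [SecondCountableTopology V] [IsLocallyFiniteMeasure μ] [μ.IsAddLeftInvariant]
    [μ.IsNegInvariant] {f φ : V → ℂ} {k : V → X} (hf : Integrable f μ)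
    (hf₁ : Integrable (fun t => ‖t‖ * ‖f t‖) μ) (hφ : Continuous φ) (hφc : HasCompactSupport φ)
    (hk : Continuous k) (hC : 0 ≤ C) (hkC : ∀ t, ‖k t‖ ≤ C * (1 + ‖t‖)) :
    (f ⋆[lsmul ℂ ℂ, μ] φ) ⋆[lsmul ℂ ℂ, μ] k = f ⋆[lsmul ℂ ℂ, μ] (φ ⋆[lsmul ℂ ℂ, μ] k) := by
  have hφ₁ : Integrable (fun t => ‖t‖ * ‖φ t‖) μ :=
    (continuous_norm.mul hφ.norm).integrable_of_hasCompactSupport hφc.norm.mul_left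
  have hφk : Continuous ((fun s => ‖φ s‖) ⋆[mul ℝ ℝ, μ] fun s => ‖k s‖) :=
    hφc.norm.continuous_convolution_left (mul ℝ ℝ) hφ.norm hk.norm.locallyIntegrable
  funext x
  exact convolution_assoc_of_hasCompactSupport hf hφ hφc hk.locallyIntegrable
    (convolutionExistsAt_norm_of_linear_growth hf hf₁ hφk (by positivity)
      (norm_convolution_norm_le_of_linear_growth (hφ.integrable_of_hasCompactSupport hφc) hφ₁
        hC hkC) x)

end LinearGrowth

section UniformContinuity

variable {V E : Type*} [NormedAddCommGroup V] [NormedSpace ℝ V]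

theorem exists_dist_le_add_mul_dist [PseudoMetricSpace E] {G : V → E} (hG : UniformContinuous G)
    {ε : ℝ} (hε : 0 < ε) : ∃ C, 0 ≤ C ∧ ∀ x y, dist (G x) (G y) ≤ ε + C * dist x y := by
  obtain ⟨δ, hδ, hd⟩ := Metric.uniformContinuous_iff.1 hG ε hε
  refine ⟨ε / δ, by positivity, fun x y => ?_⟩
  -- Chain along `n` equally spaced points of the segment from `x` to `y`.
  set n := ⌊dist x y / δ⌋₊ + 1
  have hn0 : (0 : ℝ) < n := by positivity
  have hn : dist x y / δ < n := by exact_mod_cast Nat.lt_floor_add_one (dist x y / δ)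
  let P : ℕ → V := fun k => AffineMap.lineMap x y (k / n : ℝ)
  have hstep : ∀ k, dist (P k) (P (k + 1)) < δ := fun k => by
    have : dist (k / n : ℝ) ((k + 1 : ℕ) / n : ℝ) = 1 / n := by
      rw [Real.dist_eq, ← sub_div, abs_div, abs_of_pos hn0]
      simp
    rw [dist_lineMap_lineMap, this, one_div_mul_eq_div, div_lt_iff₀ hn0]
    rwa [div_lt_iff₀ hδ, mul_comm] at hn
  have hP : dist (G (P 0)) (G (P n)) ≤ ∑ _k ∈ Finset.range n, ε :=
    dist_le_range_sum_of_dist_le (f := fun k => G (P k)) n fun _ => (hd (hstep _)).le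
  calc dist (G x) (G y) ≤ n * ε := by simpa [P, hn0.ne'] using hP
    _ ≤ (dist x y / δ + 1) * ε := by
      gcongr
      push_cast [n]
      gcongr
      exact Nat.floor_le (by positivity)
    _ = ε + ε / δ * dist x y := by ring

theorem exists_linear_growth [NormedAddCommGroup E] {G : V → E} (hG : UniformContinuous G) :
    ∃ C, 0 ≤ C ∧ ∀ t, ‖G t‖ ≤ C * (1 + ‖t‖) := by
  obtain ⟨C, hC, hGC⟩ := exists_dist_le_add_mul_dist hG one_pos
  refine ⟨‖G 0‖ + 1 + C, by positivity, fun t => ?_⟩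
  have h0 := hGC t 0
  rw [dist_zero_right, dist_eq_norm] at h0
  nlinarith [norm_le_norm_sub_add (G t) (G 0), norm_nonneg t, norm_nonneg (G 0)]

theorem uniformContinuous_of_union_eq_univ [PseudoMetricSpace E] {A B : Set V} (hA : IsClosed A)
    (hB : IsClosed B) (hAB : A ∪ B = Set.univ) {k : V → E} (hkA : UniformContinuousOn k A)
    (hkB : UniformContinuousOn k B) : UniformContinuous k := by
  have crossing : ∀ {δ : ℝ} {x y : V}, x ∈ A → y ∈ B → dist x y < δ →
      ∃ z ∈ A ∩ B, dist x z < δ ∧ dist z y < δ := fun {δ x y} hx hy hxy => by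
    obtain ⟨z, hz, hzAB⟩ := isPreconnected_closed_iff.1 (convex_segment x y).isPreconnected A B hA
      hB (by simp [hAB]) ⟨x, left_mem_segment ℝ x y, hx⟩ ⟨y, right_mem_segment ℝ x y, hy⟩
    have := dist_add_dist_of_mem_segment hz
    exact ⟨z, hzAB, by linarith [dist_nonneg (x := z) (y := y)],
      by linarith [dist_nonneg (x := x) (y := z)]⟩
  refine Metric.uniformContinuous_iff.2 fun ε hε => ?_
  obtain ⟨δA, hδA, hdA⟩ := Metric.uniformContinuousOn_iff.1 hkA (ε / 2) (half_pos hε)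
  obtain ⟨δB, hδB, hdB⟩ := Metric.uniformContinuousOn_iff.1 hkB (ε / 2) (half_pos hε)
  have hmixed : ∀ x ∈ A, ∀ y ∈ B, dist x y < min δA δB → dist (k x) (k y) < ε :=
    fun x hx y hy hxy => by
      obtain ⟨z, ⟨hzA, hzB⟩, hxz, hzy⟩ := crossing hx hy hxy
      linarith [dist_triangle (k x) (k z) (k y), hdA x hx z hzA (hxz.trans_le (min_le_left _ _)),
        hdB z hzB y hy (hzy.trans_le (min_le_right _ _))]
  refine ⟨min δA δB, lt_min hδA hδB, fun {x y} hxy => ?_⟩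
  rcases hAB.ge (Set.mem_univ x) with hx | hx <;> rcases hAB.ge (Set.mem_univ y) with hy | hy
  · linarith [hdA x hx y hy (hxy.trans_le (min_le_left _ _))]
  · exact hmixed x hx y hy hxy
  · rw [dist_comm] at hxy ⊢
    exact hmixed y hy x hx hxy
  · linarith [hdB x hx y hy (hxy.trans_le (min_le_right _ _))]

section Mollification

variable [NormedAddCommGroup E] [NormedSpace ℂ E] [CompleteSpace E] [MeasurableSpace V]
  [BorelSpace V] [SecondCountableTopology V] {μ : Measure V} {G : V → E} {ρ : V → ℂ}

theorem norm_integral_smul_sub_smul_sub_le (hG : Continuous G) {η C : ℝ}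
    (hGC : ∀ x y, dist (G x) (G y) ≤ η + C * dist x y) (hρ : Integrable ρ μ)
    (hρ₁ : Integrable (fun u => ‖u‖ * ‖ρ u‖) μ) (hρ_one : ∫ u, ρ u ∂μ = 1) (r : ℝ) (t : V) :
    ‖∫ u, ρ u • G (t - r • u) ∂μ - G t‖ ≤
      η * (∫ u, ‖ρ u‖ ∂μ) + C * |r| * ∫ u, ‖u‖ * ‖ρ u‖ ∂μ := by
  have hbound : ∀ u, ‖ρ u • (G (t - r • u) - G t)‖ ≤
      η * ‖ρ u‖ + C * |r| * (‖u‖ * ‖ρ u‖) := fun u => by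
    have hdist := hGC (t - r • u) t
    rw [dist_eq_norm, dist_eq_norm, sub_sub_cancel_left, norm_neg, norm_smul,
      Real.norm_eq_abs] at hdist
    rw [norm_smul]
    calc _ ≤ ‖ρ u‖ * (η + C * (|r| * ‖u‖)) := by gcongr
      _ = _ := by ring
  have hdom : Integrable (fun u => η * ‖ρ u‖ + C * |r| * (‖u‖ * ‖ρ u‖)) μ :=
    (hρ.norm.const_mul _).add (hρ₁.const_mul _)
  have hdiff : Integrable (fun u => ρ u • (G (t - r • u) - G t)) μ :=
    hdom.mono' (hρ.aestronglyMeasurable.smul (by fun_prop)) (.of_forall hbound)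
  have hsplit : ∫ u, ρ u • G (t - r • u) ∂μ = (∫ u, ρ u • (G (t - r • u) - G t) ∂μ) + G t := by
    calc _ = ∫ u, ρ u • (G (t - r • u) - G t) + ρ u • G t ∂μ := by
          simp only [smul_sub, sub_add_cancel]
      _ = _ := by
          rw [integral_add hdiff (hρ.smul_const _), integral_smul_const, hρ_one, one_smul]
  rw [hsplit, add_sub_cancel_right, ← integral_const_mul, ← integral_const_mul,
    ← integral_add (hρ.norm.const_mul _) (hρ₁.const_mul _)]
  exact norm_integral_le_of_norm_le hdom (.of_forall hbound)

theorem tendstoUniformly_integral_smul_sub_inv_smul (hG : UniformContinuous G)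
    (hρ : Integrable ρ μ) (hρ₁ : Integrable (fun u => ‖u‖ * ‖ρ u‖) μ)
    (hρ_one : ∫ u, ρ u ∂μ = 1) :
    TendstoUniformly (fun (R : ℝ) t => ∫ u, ρ u • G (t - R⁻¹ • u) ∂μ) G atTop := by
  refine Metric.tendstoUniformly_iff.2 fun ε hε => ?_
  set M₀ := ∫ u, ‖ρ u‖ ∂μ
  set M₁ := ∫ u, ‖u‖ * ‖ρ u‖ ∂μ
  have hpos : 0 < M₀ + 1 :=
    add_pos_of_nonneg_of_pos (integral_nonneg fun _ => norm_nonneg _) one_pos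
  obtain ⟨C, -, hGC⟩ := exists_dist_le_add_mul_dist hG (div_pos (half_pos hε) hpos)
  have hlim : Tendsto (fun R : ℝ => C * |R⁻¹| * M₁) atTop (𝓝 0) := by
    simpa using (tendsto_inv_atTop_zero.abs.const_mul C).mul_const M₁
  have hM : ε / 2 / (M₀ + 1) * M₀ ≤ ε / 2 := by
    rw [div_mul_eq_mul_div, div_le_iff₀ hpos]
    linarith
  filter_upwards [hlim.eventually_lt_const (half_pos hε)] with R hRε t
  rw [dist_comm, dist_eq_norm]
  linarith [norm_integral_smul_sub_smul_sub_le hG.continuous hGC hρ hρ₁ hρ_one R⁻¹ t]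

end Mollification

end UniformContinuity

section Fourier

variable {V : Type*} [NormedAddCommGroup V] [InnerProductSpace ℝ V]

theorem exists_schwartz_hasCompactSupport_apply_zero_eq_one [FiniteDimensional ℝ V] :
    ∃ χ : 𝓢(V, ℂ), HasCompactSupport χ ∧ χ 0 = 1 := by
  let b : ContDiffBump (0 : V) := default
  have hb : HasCompactSupport fun x => (b x : ℂ) :=
    b.hasCompactSupport.comp_left Complex.ofReal_zero
  have hb0 : b 0 = 1 := b.one_of_mem_closedBall (Metric.mem_closedBall_self b.rIn_pos.le)
  exact ⟨hb.toSchwartzMap (Complex.ofRealCLM.contDiff.comp b.contDiff), hb,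
    congrArg Complex.ofReal hb0⟩

theorem exists_schwartz_mul_eq {f : V → ℂ} (hf : ContDiff ℝ ∞ f) (χ : 𝓢(V, ℂ))
    (hχ : HasCompactSupport χ) (hne : ∀ ξ ∈ tsupport χ, f ξ ≠ 0) :
    ∃ q : 𝓢(V, ℂ), ∀ ξ, q ξ * f ξ = χ ξ := by
  have hq : ContDiff ℝ ∞ fun ξ => χ ξ * (f ξ)⁻¹ := by
    refine contDiff_iff_contDiffAt.2 fun ξ => ?_
    by_cases hξ : ξ ∈ tsupport χ
    · exact (χ.smooth ⊤).contDiffAt.mul (hf.contDiffAt.inv (hne ξ hξ))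
    · refine (contDiffAt_const (c := (0 : ℂ))).congr_of_eventuallyEq ?_
      filter_upwards [(isClosed_tsupport χ).isOpen_compl.mem_nhds hξ] with y hy
      rw [image_eq_zero_of_notMem_tsupport hy, zero_mul]
  have hqc : HasCompactSupport fun ξ => χ ξ * (f ξ)⁻¹ := hχ.mul_right
  refine ⟨hqc.toSchwartzMap hq, fun ξ => ?_⟩
  change χ ξ * (f ξ)⁻¹ * f ξ = χ ξ
  by_cases hξ : ξ ∈ tsupport χ
  · exact inv_mul_cancel_right₀ (hne ξ hξ) _
  · rw [image_eq_zero_of_notMem_tsupport hξ, zero_mul, zero_mul]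

variable [MeasurableSpace V]

/-- The involution `φ ↦ conj φ(-·)`, which conjugates the Fourier transform. -/
def conjReflect {V : Type*} [Neg V] (φ : V → ℂ) (t : V) : ℂ := starRingEnd ℂ (φ (-t))

variable [BorelSpace V] [FiniteDimensional ℝ V]

theorem fourier_conjReflect (φ : V → ℂ) (ξ : V) :
    𝓕 (conjReflect φ) ξ = starRingEnd ℂ (𝓕 φ ξ) := by
  rw [Real.fourier_eq', Real.fourier_eq', ← integral_conj, ← integral_neg_eq_self]
  simp [conjReflect, ← Complex.exp_conj, map_ofNat (starRingEnd ℂ) 2]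

theorem integrable_conjReflect {φ : V → ℂ} (hφ : Integrable φ) : Integrable (conjReflect φ) :=
  (LinearIsometryEquiv.integrable_comp_iff Complex.conjLIE).2 hφ.comp_neg

theorem fourier_conjReflect_convolution {φ : V → ℂ} (hφ : Integrable φ) (ξ : V) :
    𝓕 (conjReflect φ ⋆[lsmul ℂ ℂ] φ) ξ = (‖𝓕 φ ξ‖ ^ 2 : ℝ) := by
  rw [Real.fourier_smul_convolution_eq (integrable_conjReflect hφ) hφ, fourier_conjReflect,
    smul_eq_mul, Complex.conj_mul', Complex.ofReal_pow]

theorem norm_sq_fourier_le {φ : V → ℂ} (hφ : Integrable φ) (ξ : V) :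
    ‖𝓕 φ ξ‖ ^ 2 ≤ ∫ u, ‖(conjReflect φ ⋆[lsmul ℂ ℂ] φ) u‖ :=
  calc ‖𝓕 φ ξ‖ ^ 2 = ‖𝓕 (conjReflect φ ⋆[lsmul ℂ ℂ] φ) ξ‖ := by
        rw [fourier_conjReflect_convolution hφ, Complex.norm_real,
          Real.norm_of_nonneg (sq_nonneg _)]
    _ ≤ _ := VectorFourier.norm_fourierIntegral_le_integral_norm _ _ _ _ _

theorem fourierInv_comp_inv_smul (χ : V → ℂ) {R : ℝ} (hR : 0 < R) (t : V) :
    𝓕⁻ (fun ξ => χ (R⁻¹ • ξ)) t = R ^ Module.finrank ℝ V • 𝓕⁻ χ (R • t) := by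
  rw [Real.fourierInv_eq, Real.fourierInv_eq, ← abs_of_pos (pow_pos hR (Module.finrank ℝ V)),
    ← Measure.integral_comp_inv_smul]
  simp only [inner_smul_left, inner_smul_right, conj_trivial, mul_inv_cancel_left₀ hR.ne']

theorem exists_schwartz_convolution_eq (φ χ : 𝓢(V, ℂ)) (hχ : HasCompactSupport χ)
    (hne : ∀ ξ ∈ tsupport χ, 𝓕 φ ξ ≠ 0) :
    ∃ h : 𝓢(V, ℂ), ⇑h ⋆[lsmul ℂ ℂ] ⇑φ = ⇑(𝓕⁻ χ : 𝓢(V, ℂ)) := by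
  obtain ⟨q, hq⟩ := exists_schwartz_mul_eq ((𝓕 φ).smooth ⊤) χ hχ hne
  have hF : 𝓕 (SchwartzMap.convolution (lsmul ℂ ℂ) (𝓕⁻ q) φ) = χ := by
    rw [SchwartzMap.fourier_convolution, FourierTransform.fourier_fourierInv_eq]
    ext ξ
    exact hq ξ
  refine ⟨𝓕⁻ q, funext fun x => ?_⟩
  rw [← hF, FourierTransform.fourierInv_fourier_eq, SchwartzMap.convolution_apply]

variable {X : Type*} [NormedAddCommGroup X] [NormedSpace ℂ X]

theorem convolution_dilation (f : V → ℂ) (G : V → X) {R : ℝ} (hR : 0 < R) (t : V) :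
    ((fun s => R ^ Module.finrank ℝ V • f (R • s)) ⋆[lsmul ℂ ℂ] G) t =
      ∫ u, f u • G (t - R⁻¹ • u) := by
  have hpow : 0 < R ^ Module.finrank ℝ V := pow_pos hR _
  have := Measure.integral_comp_smul volume (fun u => f u • G (t - R⁻¹ • u)) R
  simp only [inv_smul_smul₀ hR.ne', abs_inv, abs_of_pos hpow] at this
  simp only [convolution_lsmul, smul_assoc, integral_smul, this, smul_inv_smul₀ hpow.ne']

theorem exists_bandLimited_dist_convolution_lt [CompleteSpace X] {G : V → X}
    (hG : UniformContinuous G) {ε : ℝ} (hε : 0 < ε) :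
    ∃ χ : 𝓢(V, ℂ), HasCompactSupport χ ∧
      ∀ t, dist (G t) ((⇑(𝓕⁻ χ : 𝓢(V, ℂ)) ⋆[lsmul ℂ ℂ] G) t) < ε := by
  obtain ⟨χ, hχ, hχ0⟩ := exists_schwartz_hasCompactSupport_apply_zero_eq_one (V := V)
  set ρ : 𝓢(V, ℂ) := 𝓕⁻ χ with hρ
  have hone : ∫ u, ρ u = 1 := by
    have : 𝓕 ρ 0 = 1 := by rw [hρ, FourierTransform.fourier_fourierInv_eq, hχ0]
    simpa [SchwartzMap.fourier_coe, Real.fourier_eq] using this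
  have hmoment : Integrable fun u => ‖u‖ * ‖ρ u‖ := by
    simpa using ρ.integrable_pow_mul volume 1
  obtain ⟨R, hR, hclose⟩ := ((eventually_gt_atTop 0).and
    (Metric.tendstoUniformly_iff.1 (tendstoUniformly_integral_smul_sub_inv_smul hG
      ρ.integrable hmoment hone) ε hε)).exists
  have hc : HasCompactSupport fun ξ => χ (R⁻¹ • ξ) := hχ.comp_smul (inv_ne_zero hR.ne')
  set χR : 𝓢(V, ℂ) := hc.toSchwartzMap ((χ.smooth ⊤).comp (contDiff_const_smul _))
  have hdil : ⇑(𝓕⁻ χR : 𝓢(V, ℂ)) = fun s => R ^ Module.finrank ℝ V • ρ (R • s) :=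
    funext fun s => by
      rw [SchwartzMap.fourierInv_coe, hρ, SchwartzMap.fourierInv_coe]
      exact fourierInv_comp_inv_smul χ hR s
  refine ⟨χR, hc, fun t => ?_⟩
  rw [hdil, convolution_dilation _ _ hR]
  exact hclose t

end Fourier

section Tauberian

variable {V : Type*} [NormedAddCommGroup V]

/-- Test functions on a normed space: the elements of `𝓓(V)`, as plain functions. -/
structure IsTestFunction [NormedSpace ℝ V] (φ : V → ℂ) : Prop where
  contDiff : ContDiff ℝ ∞ φ
  hasCompactSupport : HasCompactSupport φ

namespace IsTestFunction

variable [NormedSpace ℝ V] {φ ψ : V → ℂ}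

theorem continuous (hφ : IsTestFunction φ) : Continuous φ := hφ.contDiff.continuous

theorem add (hφ : IsTestFunction φ) (hψ : IsTestFunction ψ) : IsTestFunction (φ + ψ) :=
  ⟨hφ.contDiff.add hψ.contDiff, hφ.hasCompactSupport.add hψ.hasCompactSupport⟩

theorem conjReflect (hφ : IsTestFunction φ) : IsTestFunction (conjReflect φ) where
  contDiff := Complex.conjCLE.contDiff.comp (hφ.contDiff.comp contDiff_neg)
  hasCompactSupport :=
    (hφ.hasCompactSupport.comp_homeomorph (Homeomorph.neg V)).comp_left (map_zero _)

variable [MeasurableSpace V] [OpensMeasurableSpace V] {μ : Measure V} [IsFiniteMeasureOnCompacts μ]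

theorem integrable (hφ : IsTestFunction φ) : Integrable φ μ :=
  hφ.continuous.integrable_of_hasCompactSupport hφ.hasCompactSupport

end IsTestFunction

theorem IsTestFunction.convolution [NormedSpace ℝ V] [MeasurableSpace V]
    [BorelSpace V] {μ : Measure V} [IsFiniteMeasureOnCompacts μ] [μ.IsAddLeftInvariant]
    [μ.IsNegInvariant] {φ ψ : V → ℂ} (hφ : IsTestFunction φ) (hψ : IsTestFunction ψ) :
    IsTestFunction (φ ⋆[lsmul ℂ ℂ, μ] ψ) where
  contDiff := by
    rw [convolution_lsmul_comm]
    exact hφ.hasCompactSupport.contDiff_convolution_right (𝕜 := ℝ) (lsmul ℝ ℂ)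
      hψ.integrable.locallyIntegrable hφ.contDiff
  hasCompactSupport := hφ.hasCompactSupport.convolution _ hψ.hasCompactSupport

variable [InnerProductSpace ℝ V] [FiniteDimensional ℝ V] [MeasurableSpace V] [BorelSpace V]
variable {X : Type*} [NormedAddCommGroup X] [NormedSpace ℂ X]

/-- The test functions `φ` for which `φ * F` vanishes at infinity. They form an ideal of the
convolution algebra `𝓓(V)`, and the reduced spectrum of `F` is its hull. -/
def vanishingIdeal (F : V → X) : Set (V → ℂ) :=
  {φ | IsTestFunction φ ∧ Tendsto (φ ⋆[lsmul ℂ ℂ] F) (cocompact V) (𝓝 0)}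

section Ideal

variable {F : V → X} {φ ψ : V → ℂ}

theorem zero_mem_vanishingIdeal : (0 : V → ℂ) ∈ vanishingIdeal F :=
  ⟨⟨contDiff_const, .zero⟩, by rw [zero_convolution]; exact tendsto_const_nhds⟩

theorem add_mem_vanishingIdeal (hF : LocallyIntegrable F) (hφ : φ ∈ vanishingIdeal F)
    (hψ : ψ ∈ vanishingIdeal F) : φ + ψ ∈ vanishingIdeal F := by
  refine ⟨hφ.1.add hψ.1, ?_⟩
  rw [(hφ.1.hasCompactSupport.convolutionExists_left _ hφ.1.continuous hF).add_distrib
    (hψ.1.hasCompactSupport.convolutionExists_left _ hψ.1.continuous hF), ← add_zero (0 : X)]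
  exact hφ.2.add hψ.2

theorem convolution_mem_vanishingIdeal [CompleteSpace X] (hF : LocallyIntegrable F)
    (hψ : IsTestFunction ψ) (hφ : φ ∈ vanishingIdeal F) :
    ψ ⋆[lsmul ℂ ℂ] φ ∈ vanishingIdeal F := by
  refine ⟨hψ.convolution hφ.1, ?_⟩
  rw [convolution_assoc_of_hasCompactSupport_left hψ.continuous hψ.hasCompactSupport
    hφ.1.continuous hφ.1.hasCompactSupport hF]
  exact tendsto_convolution_cocompact hψ.integrable
    (hφ.1.hasCompactSupport.continuous_convolution_left _ hφ.1.continuous hF) hφ.2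

theorem exists_mem_vanishingIdeal_fourier_ne_zero_on [CompleteSpace X]
    (hF : LocallyIntegrable F) (h : ∀ ξ, ∃ φ ∈ vanishingIdeal F, 𝓕 φ ξ ≠ 0)
    {K : Set V} (hK : IsCompact K) :
    ∃ φ ∈ vanishingIdeal F, (∀ ξ, 0 ≤ 𝓕 φ ξ) ∧ ∀ ξ ∈ K, 𝓕 φ ξ ≠ 0 := by
  -- Squaring `𝓕 φ` by `φ ↦ conjReflect φ * φ` makes sums of local solutions free of cancellation.
  refine hK.induction_on ?_ ?_ ?_ fun ξ _ => ?_
  · exact ⟨0, zero_mem_vanishingIdeal, fun ξ => by simp [Real.fourier_eq'], by simp⟩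
  · rintro s t hst ⟨φ, hφ, hpos, hne⟩
    exact ⟨φ, hφ, hpos, fun ξ hξ => hne ξ (hst hξ)⟩
  · rintro s t ⟨φ, hφ, hφpos, hφne⟩ ⟨ψ, hψ, hψpos, hψne⟩
    have hadd : 𝓕 (φ + ψ) = 𝓕 φ + 𝓕 ψ := VectorFourier.fourierIntegral_add
      Real.continuous_fourierChar continuous_inner hφ.1.integrable hψ.1.integrable
    refine ⟨φ + ψ, add_mem_vanishingIdeal hF hφ hψ, fun ξ => ?_, fun ξ hξ => ?_⟩
    · rw [hadd]
      exact add_nonneg (hφpos ξ) (hψpos ξ)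
    · rw [hadd, Pi.add_apply, Ne, add_eq_zero_iff_of_nonneg (hφpos ξ) (hψpos ξ), not_and_or]
      exact hξ.imp (hφne ξ) (hψne ξ)
  · obtain ⟨φ, hφ, hξ⟩ := h ξ
    have hcont : Continuous (𝓕 φ) := VectorFourier.fourierIntegral_continuous
      Real.continuous_fourierChar continuous_inner hφ.1.integrable
    have hsq := fourier_conjReflect_convolution (φ := φ) hφ.1.integrable
    refine ⟨{η | 𝓕 φ η ≠ 0}, mem_nhdsWithin_of_mem_nhds (hcont.continuousAt.eventually_ne hξ),
      conjReflect φ ⋆[lsmul ℂ ℂ] φ, convolution_mem_vanishingIdeal hF hφ.1.conjReflect hφ,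
      fun η => ?_, fun η hη => ?_⟩
    · rw [hsq]
      exact Complex.zero_le_real.2 (sq_nonneg _)
    · rw [hsq]
      simpa using hη

end Ideal

theorem tendsto_schwartz_convolution_of_linear_growth [CompleteSpace X] {G : V → X}
    (hG : Continuous G) {C : ℝ} (hC : 0 ≤ C) (hGC : ∀ t, ‖G t‖ ≤ C * (1 + ‖t‖)) {φ : V → ℂ}
    (hφ : φ ∈ vanishingIdeal G) (k : 𝓢(V, ℂ)) :
    Tendsto ((k ⋆[lsmul ℂ ℂ] φ) ⋆[lsmul ℂ ℂ] G) (cocompact V) (𝓝 0) := by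
  rw [convolution_assoc_of_linear_growth k.integrable
    (by simpa using k.integrable_pow_mul volume 1) hφ.1.continuous hφ.1.hasCompactSupport hG hC hGC]
  exact tendsto_convolution_cocompact k.integrable
    (hφ.1.hasCompactSupport.continuous_convolution_left _ hφ.1.continuous hG.locallyIntegrable) hφ.2

theorem tendsto_convolution_of_uniformContinuous [CompleteSpace X] {F : V → X}
    (hF : LocallyIntegrable F) (h : ∀ ξ, ∃ φ ∈ vanishingIdeal F, 𝓕 φ ξ ≠ 0) {ψ : V → ℂ}
    (hψ : IsTestFunction ψ) (hG : UniformContinuous (ψ ⋆[lsmul ℂ ℂ] F)) :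
    Tendsto (ψ ⋆[lsmul ℂ ℂ] F) (cocompact V) (𝓝 0) := by
  set G := ψ ⋆[lsmul ℂ ℂ] F
  obtain ⟨C, hC, hGC⟩ := exists_linear_growth hG
  refine Metric.tendsto_nhds.2 fun ε hε => ?_
  obtain ⟨χ, hχ, hclose⟩ := exists_bandLimited_dist_convolution_lt hG (half_pos hε)
  obtain ⟨φ, hφ, -, hne⟩ := exists_mem_vanishingIdeal_fourier_ne_zero_on hF h hχ.isCompact
  let Φ : 𝓢(V, ℂ) := hφ.1.hasCompactSupport.toSchwartzMap hφ.1.contDiff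
  obtain ⟨k, hk⟩ := exists_schwartz_convolution_eq Φ χ hχ hne
  have hφG : φ ∈ vanishingIdeal G := by
    refine ⟨hφ.1, ?_⟩
    rw [convolution_left_comm hφ.1.continuous hφ.1.hasCompactSupport hψ.continuous
      hψ.hasCompactSupport hF]
    exact tendsto_convolution_cocompact hψ.integrable
      (hφ.1.hasCompactSupport.continuous_convolution_left _ hφ.1.continuous hF) hφ.2
  have hlim := tendsto_schwartz_convolution_of_linear_growth hG.continuous hC hGC hφG k
  rw [show ⇑k ⋆[lsmul ℂ ℂ] φ = _ from hk] at hlim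
  filter_upwards [Metric.tendsto_nhds.1 hlim _ (half_pos hε)] with t ht
  linarith [dist_triangle (G t) ((⇑(𝓕⁻ χ : 𝓢(V, ℂ)) ⋆[lsmul ℂ ℂ] G) t) 0, hclose t]

end Tauberian

section ExtensionByZero

theorem mem_testFns_iff {φ : ℝ → ℂ} : φ ∈ testFns ↔ IsTestFunction φ := by
  constructor
  · rintro ⟨φ, rfl⟩
    exact ⟨φ.contDiff, φ.hasCompactSupport⟩
  · exact fun hφ => ⟨⟨φ, hφ.contDiff, hφ.hasCompactSupport, Set.subset_univ _⟩, rfl⟩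

theorem hat_eq_fourier (φ : ℝ → ℂ) (w : ℝ) : hat φ w = 𝓕 φ (w / (2 * Real.pi)) := by
  have hpi : (Real.pi : ℂ) ≠ 0 := mod_cast Real.pi_ne_zero
  rw [Real.fourier_eq', hat]
  refine integral_congr_ae (.of_forall fun t => ?_)
  simp only [smul_eq_mul, RCLike.inner_apply, conj_trivial]
  congr 2
  push_cast
  field_simp

section Frontier

variable {α : Type*} [TopologicalSpace α]

theorem union_closure_compl (s : Set α) : s ∪ closure sᶜ = Set.univ :=
  Set.univ_subset_iff.1 (Set.union_compl_self s ▸ Set.union_subset_union_right s subset_closure)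

theorem nonempty_inter_frontier_of_isPreconnected {s t : Set α} (hs : IsPreconnected s)
    (ht : (s ∩ closure t).Nonempty) (htc : (s ∩ closure tᶜ).Nonempty) :
    (s ∩ frontier t).Nonempty := by
  rw [frontier_eq_closure_inter_closure]
  refine isPreconnected_closed_iff.1 hs _ _ isClosed_closure isClosed_closure ?_ ht htc
  rw [← closure_union, Set.union_compl_self, closure_univ]
  exact Set.subset_univ s

theorem isBounded_compl_union_neg {J : Set ℝ} (hfr : Bornology.IsBounded (frontier J))
    (hJ : ¬ Bornology.IsBounded J) : Bornology.IsBounded (J ∪ -J)ᶜ := by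
  obtain ⟨R, hR⟩ := hfr.subset_closedBall 0
  obtain ⟨x, hxJ, hx⟩ : ∃ x ∈ J, x ∉ Metric.closedBall 0 R :=
    Set.not_subset.1 fun h => hJ (Metric.isBounded_closedBall.subset h)
  have mem_of_isPreconnected {s : Set ℝ} {y : ℝ} (hs : IsPreconnected s)
      (hsR : ∀ z ∈ s, R < |z|) (hxs : x ∈ s) (hys : y ∈ s) : y ∈ J := by
    by_contra hyJ
    obtain ⟨z, hzs, hzfr⟩ := nonempty_inter_frontier_of_isPreconnected hs
      ⟨x, hxs, subset_closure hxJ⟩ ⟨y, hys, subset_closure hyJ⟩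
    exact (hsR z hzs).not_ge (by simpa using hR hzfr)
  refine (Metric.isBounded_closedBall (x := (0 : ℝ)) (r := R)).subset fun y hy =>
    by_contra fun hyR => hy ?_
  simp only [mem_closedBall_zero_iff, Real.norm_eq_abs, not_le] at hx hyR
  rcases lt_abs.1 hx with hx | hx
  · have hyJ : |y| ∈ J :=
      mem_of_isPreconnected isPreconnected_Ioi (fun z hz => lt_abs.2 (.inl hz)) hx hyR
    rcases abs_choice y with h | h <;> rw [h] at hyJ
    exacts [.inl hyJ, .inr hyJ]
  · have hyJ : -|y| ∈ J :=
      mem_of_isPreconnected isPreconnected_Iio (fun z hz => lt_abs.2 (.inr (lt_neg_of_lt_neg hz)))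
        (lt_neg_of_lt_neg hx) (neg_lt_neg hyR)
    rcases abs_choice y with h | h <;> rw [h] at hyJ
    exacts [.inr hyJ, .inl (neg_neg y ▸ hyJ)]

end Frontier

section C0

variable {E : Type*} [NormedAddCommGroup E] {J : Set ℝ} {k : ℝ → E}

theorem domRestrict_mem_C0_iff (hJ : IsClosed J) (hk : Continuous k) :
    J.domRestrict k ∈ C0 J E ↔ Tendsto k (cocompact ℝ ⊓ 𝓟 J) (𝓝 0) := by
  have hco : cocompact J = comap ((↑) : J → ℝ) (cocompact ℝ) :=
    le_antisymm hJ.isClosedEmbedding_subtypeVal.tendsto_cocompact.le_comap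
      (comap_cocompact_le continuous_subtype_val)
  have hmap : cocompact ℝ ⊓ 𝓟 J = map ((↑) : J → ℝ) (cocompact J) := by
    rw [hco, map_comap, Subtype.range_coe]
  rw [hmap, tendsto_map'_iff]
  constructor
  · rintro ⟨g, hg⟩
    exact (congrArg (Tendsto · (cocompact J) (𝓝 0)) hg).mp g.zero_at_infty'
  · exact fun h => ⟨⟨⟨J.domRestrict k, hk.comp continuous_subtype_val⟩, h⟩, rfl⟩

theorem uniformContinuousOn_of_domRestrict_mem_C0 (h : J.domRestrict k ∈ C0 J E) :
    UniformContinuousOn k J := by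
  obtain ⟨g, hg⟩ := h
  rw [uniformContinuousOn_iff_restrict]
  exact hg ▸ ZeroAtInftyContinuousMap.uniformContinuous g

end C0

theorem locallyIntegrable_indicator {V E : Type*} [TopologicalSpace V] [WeaklyLocallyCompactSpace V]
    [MeasurableSpace V] [OpensMeasurableSpace V] [NormedAddCommGroup E] {μ : Measure V} {J : Set V}
    (hJ : IsClosed J) {F : V → E} (hF : LocallyIntegrableOn F J μ) :
    LocallyIntegrable (J.indicator F) μ := by
  intro x
  obtain ⟨K, hK, hxK⟩ := exists_compact_mem_nhds x
  refine ⟨K, hxK, ?_⟩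
  rw [IntegrableOn, integrable_indicator_iff hJ.measurableSet, IntegrableOn,
    Measure.restrict_restrict hJ.measurableSet]
  exact hF.integrableOn_compact_subset Set.inter_subset_left (hK.inter_left hJ)

variable {X : Type*} [NormedAddCommGroup X] [NormedSpace ℂ X]
variable {J : Set ℝ} {F : ℝ → X} {φ ψ : ℝ → ℂ}

theorem continuous_extConv (hJ : IsClosed J) (hF : LocallyIntegrableOn F J)
    (hφ : IsTestFunction φ) : Continuous (extConv J F φ) :=
  hφ.hasCompactSupport.continuous_convolution_left _ hφ.continuous
    (locallyIntegrable_indicator hJ hF)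

theorem eventually_extConv_eq_zero (hfr : Bornology.IsBounded (frontier J)) (F : ℝ → X)
    (hφ : HasCompactSupport φ) :
    ∀ᶠ t in cocompact ℝ, t ∈ closure Jᶜ → extConv J F φ t = 0 := by
  obtain ⟨r, hr⟩ := hφ.isCompact.isBounded.subset_closedBall 0
  have hK : IsCompact (Metric.cthickening r (frontier J)) :=
    Metric.isCompact_of_isClosed_isBounded Metric.isClosed_cthickening hfr.cthickening
  filter_upwards [hK.compl_mem_cocompact] with t ht htJ
  rw [extConv, convolution_lsmul]
  refine integral_eq_zero_of_ae (.of_forall fun s => ?_)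
  by_contra hs
  have hsJ : t - s ∈ J := Set.mem_of_indicator_ne_zero (right_ne_zero_of_smul hs)
  have hsr : dist (t - s) t ≤ r := by
    simpa using hr (subset_tsupport φ (left_ne_zero_of_smul hs))
  obtain ⟨z, hz, hzfr⟩ := nonempty_inter_frontier_of_isPreconnected
    (convex_segment (t - s) t).isPreconnected ⟨_, left_mem_segment ℝ _ t, subset_closure hsJ⟩
    ⟨_, right_mem_segment ℝ _ t, htJ⟩
  refine ht (Metric.mem_cthickening_of_dist_le t z r _ hzfr ?_)
  rw [dist_comm]
  linarith [dist_add_dist_of_mem_segment hz, dist_nonneg (x := t - s) (y := z)]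

theorem tendsto_extConv_inf_principal_closure_compl
    (hfr : Bornology.IsBounded (frontier J)) (F : ℝ → X) (hφ : HasCompactSupport φ) :
    Tendsto (extConv J F φ) (cocompact ℝ ⊓ 𝓟 (closure Jᶜ)) (𝓝 0) :=
  tendsto_const_nhds.congr' <| eventually_inf_principal.2 <|
    (eventually_extConv_eq_zero hfr F hφ).mono fun _ h ht => (h ht).symm

theorem mem_vanishingIdeal_of_domRestrict_mem_C0 (hJ : IsClosed J)
    (hfr : Bornology.IsBounded (frontier J)) (hF : LocallyIntegrableOn F J)
    (hφ : IsTestFunction φ) (h : J.domRestrict (extConv J F φ) ∈ C0 J X) :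
    φ ∈ vanishingIdeal (J.indicator F) := by
  rw [domRestrict_mem_C0_iff hJ (continuous_extConv hJ hF hφ)] at h
  have hsup := h.sup (tendsto_extConv_inf_principal_closure_compl hfr F hφ.hasCompactSupport)
  rw [← inf_sup_left, sup_principal, union_closure_compl, principal_univ, inf_top_eq] at hsup
  exact ⟨hφ, hsup⟩

theorem uniformContinuous_extConv (hJ : IsClosed J) (hfr : Bornology.IsBounded (frontier J))
    (hF : LocallyIntegrableOn F J) (hφ : IsTestFunction φ)
    (h : UniformContinuousOn (extConv J F φ) J) : UniformContinuous (extConv J F φ) := by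
  refine uniformContinuous_of_union_eq_univ hJ isClosed_closure (union_closure_compl J) h
    (uniformContinuousOn_of_domRestrict_mem_C0 ?_)
  rw [domRestrict_mem_C0_iff isClosed_closure (continuous_extConv hJ hF hφ)]
  exact tendsto_extConv_inf_principal_closure_compl hfr F hφ.hasCompactSupport

theorem exists_C0_eq_extConv [CompleteSpace X] (hJ : IsClosed J)
    (hfr : Bornology.IsBounded (frontier J)) (hF : LocallyIntegrableOn F J)
    (hsp : reducedSpectrum J (C0 J X) testFns F = ∅) (hψ : IsTestFunction ψ)
    (hUC : UniformContinuousOn (extConv J F ψ) J) :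
    ∃ g : C₀(ℝ, X), (g : ℝ → X) = extConv J F ψ := by
  refine ⟨⟨⟨extConv J F ψ, continuous_extConv hJ hF hψ⟩, ?_⟩, rfl⟩
  refine tendsto_convolution_of_uniformContinuous (locallyIntegrable_indicator hJ hF)
    (fun ξ => ?_) hψ (uniformContinuous_extConv hJ hfr hF hψ hUC)
  have hξ : 2 * Real.pi * ξ ∉ reducedSpectrum J (C0 J X) testFns F := hsp ▸ Set.notMem_empty _
  simp only [reducedSpectrum, Set.mem_ofPred_eq, not_forall] at hξ
  obtain ⟨φ, hφ, hmem, hne⟩ := hξ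
  rw [hat_eq_fourier, mul_div_cancel_left₀ _ Real.two_pi_pos.ne'] at hne
  exact ⟨φ, mem_vanishingIdeal_of_domRestrict_mem_C0 hJ hfr hF
    (mem_testFns_iff.1 hφ) hmem, hne⟩

end ExtensionByZero

section MemLp

theorem enorm_convolution_le_eLpNorm_mul_eLpNorm {V E : Type*} [AddCommGroup V]
    [MeasurableSpace V] [MeasurableAdd V] [MeasurableNeg V] {μ : Measure V} [μ.IsAddLeftInvariant]
    [μ.IsNegInvariant] [NormedAddCommGroup E] [NormedSpace ℂ E] {φ : V → ℂ} {u : V → E}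
    (hφ : AEStronglyMeasurable φ μ) (hu : AEStronglyMeasurable u μ) (p q : ℝ≥0∞)
    [hpq : ENNReal.HolderConjugate p q] (t : V) :
    ‖(φ ⋆[lsmul ℂ ℂ, μ] u) t‖ₑ ≤ eLpNorm φ q μ * eLpNorm u p μ := by
  have hmp : MeasurePreserving (fun s => t - s) μ μ := Measure.measurePreserving_sub_left μ t
  have : ENNReal.HolderTriple q p 1 := hpq.symm
  calc ‖(φ ⋆[lsmul ℂ ℂ, μ] u) t‖ₑ
      ≤ ∫⁻ s, ‖φ s • u (t - s)‖ₑ ∂μ := enorm_integral_le_lintegral_enorm _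
    _ = eLpNorm (φ • fun s => u (t - s)) 1 μ := eLpNorm_one_eq_lintegral_enorm.symm
    _ ≤ eLpNorm φ q μ * eLpNorm (u ∘ fun s => t - s) p μ :=
      eLpNorm_smul_le_mul_eLpNorm (hu.comp_measurePreserving hmp) hφ
    _ = _ := by rw [eLpNorm_comp_measurePreserving hu hmp]

theorem tendsto_convolution_of_memLp {V E : Type*} [NormedAddCommGroup V] [ProperSpace V]
    [MeasurableSpace V] [BorelSpace V] {μ : Measure V} [IsLocallyFiniteMeasure μ]
    [μ.IsAddLeftInvariant] [μ.IsNegInvariant] [NormedAddCommGroup E] [NormedSpace ℂ E] {p : ℝ≥0∞}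
    (hp : 1 ≤ p) (hp_top : p ≠ ⊤) {u : V → E} (hu : MemLp u p μ) {φ : V → ℂ}
    (hφ : Continuous φ) (hφc : HasCompactSupport φ) :
    Tendsto (φ ⋆[lsmul ℂ ℂ, μ] u) (cocompact V) (𝓝 0) := by
  have : ENNReal.HolderConjugate p p.conjExponent := .conjExponent hp
  have hφq : MemLp φ p.conjExponent μ := hφ.memLp_of_hasCompactSupport hφc
  rw [Metric.tendsto_nhds]
  intro ε hε
  obtain ⟨δ, hδ, hδε⟩ :=
    ENNReal.exists_pos_mul_lt hφq.eLpNorm_ne_top (ENNReal.ofReal_pos.2 hε).ne'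
  obtain ⟨g, hgc, hgδ, hg, hgp⟩ :=
    hu.exists_hasCompactSupport_eLpNorm_sub_le hp_top hδ.ne'
  filter_upwards [(hφc.convolution (lsmul ℂ ℂ) hgc (μ := μ)).isCompact.compl_mem_cocompact]
    with t ht
  have hut : (φ ⋆[lsmul ℂ ℂ, μ] u) t = (φ ⋆[lsmul ℂ ℂ, μ] (u - g)) t := by
    have hadd := (hφc.convolutionExists_left (lsmul ℂ ℂ) hφ
      ((hu.sub hgp).locallyIntegrable hp) t).distrib_add
      (hφc.convolutionExists_left (lsmul ℂ ℂ) hφ hg.locallyIntegrable t)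
    rwa [sub_add_cancel, image_eq_zero_of_notMem_tsupport ht, add_zero] at hadd
  rw [dist_zero_right, hut, ← ENNReal.ofReal_lt_ofReal_iff hε, ofReal_norm]
  calc ‖(φ ⋆[lsmul ℂ ℂ, μ] (u - g)) t‖ₑ
      ≤ eLpNorm φ p.conjExponent μ * eLpNorm (u - g) p μ :=
        enorm_convolution_le_eLpNorm_mul_eLpNorm hφq.1 (hu.sub hgp).1 p _ t
    _ ≤ eLpNorm φ p.conjExponent μ * δ := by gcongr
    _ < ENNReal.ofReal ε := by rwa [mul_comm]

theorem exists_isTestFunction_hat_ne_zero (w : ℝ) : ∃ φ, IsTestFunction φ ∧ hat φ w ≠ 0 := by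
  let b : ContDiffBump (0 : ℝ) := default
  refine ⟨fun t => Complex.exp (Complex.I * w * t) * b t, ⟨?_, ?_⟩, ?_⟩
  · exact (contDiff_const.mul Complex.ofRealCLM.contDiff).cexp.mul
      (Complex.ofRealCLM.contDiff.comp b.contDiff)
  · exact (b.hasCompactSupport.comp_left Complex.ofReal_zero).mul_left
  · have hmod (t : ℝ) : Complex.exp (-(Complex.I * w * t)) *
        (Complex.exp (Complex.I * w * t) * b t) = b t := by
      rw [← mul_assoc, ← Complex.exp_add, neg_add_cancel, Complex.exp_zero, one_mul]
    simp only [hat, hmod, integral_complex_ofReal]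
    exact Complex.ofReal_ne_zero.2 b.integral_pos.ne'

variable {X : Type*} [NormedAddCommGroup X] {J : Set ℝ} {F : ℝ → X} {p : ℝ≥0∞} {φ : ℝ → ℂ}

theorem locallyIntegrableOn_of_memLp (hp : 1 ≤ p) (hF : MemLp F p (volume.restrict J)) :
    LocallyIntegrableOn F J :=
  locallyIntegrableOn_of_locallyIntegrable_restrict (hF.locallyIntegrable hp)

variable [NormedSpace ℂ X]

theorem tendsto_extConv_of_memLp (hJ : IsClosed J) (hp : 1 ≤ p) (hp_top : p ≠ ⊤)
    (hF : MemLp F p (volume.restrict J)) (hφ : IsTestFunction φ) :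
    Tendsto (extConv J F φ) (cocompact ℝ) (𝓝 0) := by
  have hF' : MemLp (J.indicator F) p := (memLp_indicator_iff_restrict hJ.measurableSet).2 hF
  exact tendsto_convolution_of_memLp hp hp_top hF' hφ.continuous hφ.hasCompactSupport

theorem reducedSpectrum_eq_empty_of_memLp (hJ : IsClosed J) (hp : 1 ≤ p) (hp_top : p ≠ ⊤)
    (hF : MemLp F p (volume.restrict J)) : reducedSpectrum J (C0 J X) testFns F = ∅ := by
  refine Set.eq_empty_of_forall_notMem fun w hw => ?_
  obtain ⟨φ, hφ, hne⟩ := exists_isTestFunction_hat_ne_zero w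
  refine hne (hw φ (mem_testFns_iff.2 hφ) ?_)
  rw [domRestrict_mem_C0_iff hJ (continuous_extConv hJ (locallyIntegrableOn_of_memLp hp hF) hφ)]
  exact (tendsto_extConv_of_memLp hJ hp hp_top hF hφ).mono_left inf_le_left

theorem uniformContinuous_extConv_of_memLp (hJ : IsClosed J) (hp : 1 ≤ p) (hp_top : p ≠ ⊤)
    (hF : MemLp F p (volume.restrict J)) (hφ : IsTestFunction φ) :
    UniformContinuous (extConv J F φ) :=
  (continuous_extConv hJ (locallyIntegrableOn_of_memLp hp hF)
    hφ).uniformContinuous_of_tendsto_cocompact (tendsto_extConv_of_memLp hJ hp hp_top hF hφ)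

end MemLp

section UnboundedPairings

theorem eLpNorm_rpow_le_eLpNorm_top_rpow_mul {α E : Type*} [MeasurableSpace α] {μ : Measure α}
    [NormedAddCommGroup E] {f : α → E} (hf : AEStronglyMeasurable f μ) {p : ℝ≥0∞} {r : ℝ}
    (hr : 0 < r) (hrp : r ≤ p.toReal) :
    eLpNorm f p μ ^ p.toReal ≤ eLpNorm f ⊤ μ ^ (p.toReal - r) * ∫⁻ x, ‖f x‖ₑ ^ r ∂μ := by
  have hp := hr.trans_le hrp
  obtain ⟨hp₀, hp_top⟩ := ENNReal.toReal_pos_iff.1 hp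
  rw [eLpNorm_eq_lintegral_rpow_enorm_toReal hp₀.ne' hp_top.ne, ← ENNReal.rpow_mul,
    one_div_mul_cancel hp.ne', ENNReal.rpow_one, ← lintegral_const_mul'' _ (hf.enorm.pow_const r)]
  refine lintegral_mono_ae ?_
  filter_upwards [ae_le_eLpNormEssSup (f := f) (μ := μ)] with x hx
  calc ‖f x‖ₑ ^ p.toReal = ‖f x‖ₑ ^ (p.toReal - r) * ‖f x‖ₑ ^ r := by
        rw [← ENNReal.rpow_add_of_nonneg _ _ (sub_nonneg.2 hrp) hr.le, sub_add_cancel]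
    _ ≤ eLpNorm f ⊤ μ ^ (p.toReal - r) * ‖f x‖ₑ ^ r := by
        rw [eLpNorm_exponent_top]
        gcongr

theorem lintegral_le_two_mul_setLIntegral_add {V : Type*} [InvolutiveNeg V] [MeasurableSpace V]
    [MeasurableNeg V] {μ : Measure V} [μ.IsNegInvariant] {f : V → ℝ≥0∞}
    (hf : ∀ x, f (-x) = f x) {J : Set V} (hJ : MeasurableSet J) :
    ∫⁻ x, f x ∂μ ≤ 2 * ∫⁻ x in J, f x ∂μ + ∫⁻ x in (J ∪ -J)ᶜ, f x ∂μ := by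
  have hneg : ∫⁻ x in -J, f x ∂μ = ∫⁻ x in J, f x ∂μ := by
    rw [← (Measure.measurePreserving_neg μ).setLIntegral_comp_preimage_emb
      (MeasurableEquiv.neg V).measurableEmbedding, Set.neg_preimage, neg_neg]
    simp only [hf]
  rw [← lintegral_add_compl f (hJ.union hJ.neg), two_mul]
  gcongr
  exact (lintegral_union_le f J (-J)).trans_eq (by rw [hneg])

variable {α ι : Type*} [MeasurableSpace α] {μ : Measure α} {p : ℝ≥0∞}

theorem exists_lintegral_enorm_sq_le_mul_eLpNorm (hp : 1 ≤ p) {S : ι → α → ℂ}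
    (hS : ∀ i, MemLp (S i) p μ) (hS' : ∀ i, MemLp (S i) p.conjExponent μ)
    (h : ∀ f : α → ℂ, MemLp f p μ → ∃ C, ∀ i, ‖∫ x, S i x * f x ∂μ‖ ≤ C) :
    ∃ C : ℝ≥0∞, C ≠ ⊤ ∧ ∀ i, ∫⁻ x, ‖S i x‖ₑ ^ 2 ∂μ ≤ C * eLpNorm (S i) p μ := by
  have : Fact (1 ≤ p) := ⟨hp⟩
  have hpq : ENNReal.HolderConjugate p p.conjExponent := .conjExponent hp
  have : ENNReal.HolderConjugate p.conjExponent p := hpq.symm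
  have : Fact (1 ≤ p.conjExponent) := ⟨ENNReal.HolderConjugate.one_le _ p⟩
  let T (i : ι) : Lp ℂ p μ →L[ℂ] ℂ :=
    (ContinuousLinearMap.mul ℂ ℂ).lpPairing μ p.conjExponent p ((hS' i).toLp _)
  have hT (i : ι) (f : Lp ℂ p μ) : T i f = ∫ x, S i x * f x ∂μ := by
    rw [lpPairing_eq_integral]
    refine integral_congr_ae ?_
    filter_upwards [(hS' i).coeFn_toLp] with x hx
    rw [hx, mul_apply']
  obtain ⟨C, hC⟩ := banach_steinhaus (g := T) fun f => by
    simpa only [hT] using h f (Lp.memLp f)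
  refine ⟨ENNReal.ofReal C, ENNReal.ofReal_ne_top, fun i => ?_⟩
  have hstar : MemLp (star (S i)) p μ := (hS i).star
  have hTstar : ‖T i (hstar.toLp _)‖ = ∫ x, ‖S i x * star (S i) x‖ ∂μ := by
    have hself (x : α) : S i x * star (S i) x = (‖S i x * star (S i) x‖ : ℝ) := by
      simp [Complex.mul_conj', pow_two]
    rw [hT, integral_congr_ae (hstar.coeFn_toLp.mono fun x hx => congrArg (S i x * ·) hx),
      integral_congr_ae (.of_forall hself), integral_complex_ofReal, Complex.norm_real,
      Real.norm_of_nonneg (integral_nonneg fun x => norm_nonneg _)]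
  calc ∫⁻ x, ‖S i x‖ₑ ^ 2 ∂μ = ∫⁻ x, ‖S i x * star (S i) x‖ₑ ∂μ := by simp [pow_two]
    _ = ENNReal.ofReal ‖T i (hstar.toLp _)‖ := by
      rw [hTstar]
      exact (ofReal_integral_norm_eq_lintegral_enorm ((hS' i).integrable_mul hstar)).symm
    _ ≤ ENNReal.ofReal (C * ‖hstar.toLp _‖) :=
      ENNReal.ofReal_le_ofReal ((T i).le_of_opNorm_le (hC i) _)
    _ = ENNReal.ofReal C * eLpNorm (S i) p μ := by
      rw [ENNReal.ofReal_mul ((norm_nonneg _).trans (hC i)), Lp.norm_toLp,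
        ENNReal.ofReal_toReal hstar.eLpNorm_ne_top, eLpNorm_star]

theorem tendsto_eLpNorm_of_tendsto_eLpNorm_top {E : Type*} [NormedAddCommGroup E] {l : Filter ι}
    {S : ι → α → E} (hS : ∀ i, AEStronglyMeasurable (S i) μ)
    (htop : Tendsto (fun i => eLpNorm (S i) ⊤ μ) l (𝓝 0)) {r : ℝ} (hr : 0 < r) {M : ℝ≥0∞}
    (hM : M ≠ ⊤) (hbdd : ∀ i, ∫⁻ x, ‖S i x‖ₑ ^ r ∂μ ≤ M) (hrp : r < p.toReal) :
    Tendsto (fun i => eLpNorm (S i) p μ) l (𝓝 0) := by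
  have hp : 0 < p.toReal := hr.trans hrp
  have hlim : Tendsto (fun i => (eLpNorm (S i) ⊤ μ ^ (p.toReal - r) * M) ^ p.toReal⁻¹) l
      (𝓝 ((0 ^ (p.toReal - r) * M) ^ p.toReal⁻¹)) :=
    (ENNReal.Tendsto.mul_const (htop.ennrpow_const _) (.inr hM)).ennrpow_const _
  rw [ENNReal.zero_rpow_of_pos (sub_pos.2 hrp), zero_mul,
    ENNReal.zero_rpow_of_pos (inv_pos.2 hp)] at hlim
  refine tendsto_of_tendsto_of_tendsto_of_le_of_le tendsto_const_nhds hlim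
    (fun _ => zero_le) fun i => (ENNReal.le_rpow_inv_iff hp).2 ?_
  exact (eLpNorm_rpow_le_eLpNorm_top_rpow_mul (hS i) hr hrp.le).trans (by gcongr; exact hbdd i)

theorem tendsto_setLIntegral_enorm_sq_of_tendsto_eLpNorm_top {E : Type*} [NormedAddCommGroup E]
    {l : Filter ι} {S : ι → α → E} (htop : Tendsto (fun i => eLpNorm (S i) ⊤ μ) l (𝓝 0))
    {B : Set α} (hB : μ B ≠ ⊤) :
    Tendsto (fun i => ∫⁻ x in B, ‖S i x‖ₑ ^ 2 ∂μ) l (𝓝 0) := by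
  have hlim : Tendsto (fun i => eLpNorm (S i) ⊤ μ ^ 2 * μ B) l (𝓝 (0 ^ 2 * μ B)) :=
    ENNReal.Tendsto.mul_const (((ENNReal.continuous_pow 2).tendsto 0).comp htop) (.inr hB)
  rw [zero_pow two_ne_zero, zero_mul] at hlim
  refine tendsto_of_tendsto_of_tendsto_of_le_of_le tendsto_const_nhds hlim
    (fun _ => zero_le) fun i => ?_
  calc ∫⁻ x in B, ‖S i x‖ₑ ^ 2 ∂μ ≤ ∫⁻ _ in B, eLpNorm (S i) ⊤ μ ^ 2 ∂μ := by
        refine lintegral_mono_ae (ae_restrict_of_ae ?_)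
        filter_upwards [ae_le_eLpNormEssSup (f := S i) (μ := μ)] with x hx
        rw [eLpNorm_exponent_top]
        gcongr
    _ = eLpNorm (S i) ⊤ μ ^ 2 * μ B := setLIntegral_const _ _

theorem exists_memLp_forall_exists_lt_norm_setIntegral_mul {V : Type*} [InvolutiveNeg V]
    [MeasurableSpace V] [MeasurableNeg V] {μ : Measure V} [μ.IsNegInvariant] {l : Filter ι}
    [l.NeBot] {S : ι → V → ℂ} (hp : 2 < p) (hp_top : p ≠ ⊤) (hS : ∀ i, MemLp (S i) p μ)
    (hS' : ∀ i, MemLp (S i) p.conjExponent μ) (heven : ∀ i x, S i (-x) = S i x)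
    (htop : Tendsto (fun i => eLpNorm (S i) ⊤ μ) l (𝓝 0)) {M : ℝ≥0∞} (hM₀ : M ≠ 0) (hM : M ≠ ⊤)
    (hSM : ∀ i, ∫⁻ x, ‖S i x‖ₑ ^ 2 ∂μ = M) {J : Set V} (hJ : MeasurableSet J)
    (hJ' : μ (J ∪ -J)ᶜ ≠ ⊤) :
    ∃ f : V → ℂ, MemLp f p (μ.restrict J) ∧ ∀ C, ∃ i, C < ‖∫ x in J, S i x * f x ∂μ‖ := by
  by_contra! hbdd
  obtain ⟨C, hC, hCS⟩ := exists_lintegral_enorm_sq_le_mul_eLpNorm (one_le_two.trans hp.le)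
    (fun i => (hS i).restrict J) (fun i => (hS' i).restrict J) hbdd
  have hSp : Tendsto (fun i => eLpNorm (S i) p μ) l (𝓝 0) :=
    tendsto_eLpNorm_of_tendsto_eLpNorm_top (fun i => (hS i).1) htop two_pos hM
      (fun i => by simpa only [ENNReal.rpow_two] using (hSM i).le)
      (by simpa using (ENNReal.toReal_lt_toReal ENNReal.ofNat_ne_top hp_top).2 hp)
  have hlim : Tendsto (fun i => 2 * (C * eLpNorm (S i) p μ) +
      ∫⁻ x in (J ∪ -J)ᶜ, ‖S i x‖ₑ ^ 2 ∂μ) l (𝓝 (2 * (C * 0) + 0)) :=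
    (ENNReal.Tendsto.const_mul (ENNReal.Tendsto.const_mul hSp (.inr hC))
      (.inr ENNReal.ofNat_ne_top)).add
      (tendsto_setLIntegral_enorm_sq_of_tendsto_eLpNorm_top htop hJ')
  rw [mul_zero, mul_zero, add_zero] at hlim
  refine hM₀ (le_zero_iff.1 (ge_of_tendsto' hlim fun i => ?_))
  rw [← hSM i]
  refine (lintegral_le_two_mul_setLIntegral_add (fun x => by rw [heven]) hJ).trans ?_
  gcongr
  exact (hCS i).trans (by gcongr; exact Measure.restrict_le_self)

end UnboundedPairings

section Chirp

variable {V : Type*} [NormedAddCommGroup V]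

/-- The chirp with amplitude `b` and rate `r`, that is `t ↦ exp (π i r ‖t‖²) b(t)`: its energy
is that of `b`, but its Fourier transform spreads out as `r → ∞`. -/
noncomputable def chirp (b : V → ℂ) (r : ℝ) (t : V) : ℂ := 𝐞 (r * ‖t‖ ^ 2 / 2) • b t

theorem norm_chirp (b : V → ℂ) (r : ℝ) (t : V) : ‖chirp b r t‖ = ‖b t‖ := Circle.norm_smul _ _

theorem isTestFunction_chirp [InnerProductSpace ℝ V] {b : V → ℂ} (hb : IsTestFunction b) (r : ℝ) :
    IsTestFunction (chirp b r) where
  contDiff := by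
    have hphase : ContDiff ℝ ∞ fun t : V => 2 * Real.pi * (r * ‖t‖ ^ 2 / 2) :=
      contDiff_const.mul ((contDiff_const.mul (contDiff_norm_sq ℝ)).div_const 2)
    have hchirp : chirp b r = fun t : V =>
        Complex.exp ((2 * Real.pi * (r * ‖t‖ ^ 2 / 2) : ℝ) * Complex.I) • b t :=
      funext fun t => by rw [chirp, Circle.smul_def, Real.fourierChar_apply]
    rw [hchirp]
    exact ((Complex.ofRealCLM.contDiff.comp hphase).mul contDiff_const).cexp.smul hb.contDiff
  hasCompactSupport := hb.hasCompactSupport.mono fun t ht h => ht (by simp [chirp, h])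

theorem integrable_chirp [MeasurableSpace V] [OpensMeasurableSpace V] {μ : Measure V} {b : V → ℂ}
    (hb : Integrable b μ) (r : ℝ) : Integrable (chirp b r) μ := by
  have hphase : Measurable fun t : V => (𝐞 (r * ‖t‖ ^ 2 / 2) : ℂ) := by fun_prop
  exact hb.mono (hphase.aestronglyMeasurable.smul hb.1) (.of_forall fun t => (norm_chirp b r t).le)

variable [InnerProductSpace ℝ V] [FiniteDimensional ℝ V] [MeasurableSpace V] [BorelSpace V]

theorem conjReflect_chirp_convolution_chirp (b : V → ℂ) (r : ℝ) (u : V) :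
    (conjReflect (chirp b r) ⋆[lsmul ℂ ℂ] chirp b r) u =
      𝐞 (r * ‖u‖ ^ 2 / 2) • ∫ s, 𝐞 (-inner ℝ s (r • -u)) • (starRingEnd ℂ (b s) * b (u + s)) := by
  rw [convolution_lsmul, ← integral_neg_eq_self, Circle.smul_def, ← integral_smul]
  refine integral_congr_ae (.of_forall fun s => ?_)
  have hphase : (𝐞 (-(r * ‖s‖ ^ 2 / 2)) : ℂ) * 𝐞 (r * ‖u + s‖ ^ 2 / 2) =
      𝐞 (r * ‖u‖ ^ 2 / 2) * 𝐞 (-inner ℝ s (r • -u)) := by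
    rw [← Circle.coe_mul, ← Circle.coe_mul, ← AddChar.map_add_eq_mul, ← AddChar.map_add_eq_mul,
      norm_add_sq_real, inner_smul_right, inner_neg_right, real_inner_comm]
    congr 2
    ring
  have hconj (x : ℝ) : starRingEnd ℂ (𝐞 x : ℂ) = 𝐞 (-x) := by
    rw [← Circle.coe_inv_eq_conj, AddChar.map_neg_eq_inv]
  simp only [conjReflect, chirp, neg_neg, sub_neg_eq_add, Circle.smul_def, smul_eq_mul, map_mul,
    hconj]
  linear_combination (starRingEnd ℂ (b s) * b (u + s)) * hphase

theorem tendsto_conjReflect_chirp_convolution_chirp (b : V → ℂ) {u : V} (hu : u ≠ 0) :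
    Tendsto (fun r => (conjReflect (chirp b r) ⋆[lsmul ℂ ℂ] chirp b r) u) atTop (𝓝 0) := by
  have hcoc : Tendsto (fun r : ℝ => r • -u) atTop (cocompact V) :=
    (isClosedEmbedding_smul_left (neg_ne_zero.2 hu)).tendsto_cocompact.mono_left
      atTop_le_cocompact
  rw [tendsto_zero_iff_norm_tendsto_zero]
  simp only [conjReflect_chirp_convolution_chirp, Circle.norm_smul]
  exact tendsto_zero_iff_norm_tendsto_zero.1
    ((tendsto_integral_exp_inner_smul_cocompact fun s => starRingEnd ℂ (b s) * b (u + s)).comp hcoc)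

theorem tendsto_integral_norm_conjReflect_chirp_convolution_chirp [Nontrivial V] {b : V → ℂ}
    (hb : Integrable b) :
    Tendsto (fun r => ∫ u, ‖(conjReflect (chirp b r) ⋆[lsmul ℂ ℂ] chirp b r) u‖) atTop (𝓝 0) := by
  have hint (r : ℝ) : Integrable (conjReflect (chirp b r) ⋆[lsmul ℂ ℂ] chirp b r) :=
    have hchirp := integrable_chirp hb r
    (integrable_conjReflect hchirp).integrable_convolution _ hchirp
  rw [← integral_zero V ℝ]
  refine tendsto_integral_filter_of_dominated_convergence
    ((fun t => ‖b (-t)‖) ⋆[mul ℝ ℝ] fun t => ‖b t‖) (.of_forall fun r => (hint r).1.norm)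
    (.of_forall fun r => .of_forall fun u => ?_)
    (hb.comp_neg.norm.integrable_convolution _ hb.norm) ?_
  · rw [norm_norm, convolution_lsmul, convolution_mul]
    refine (norm_integral_le_integral_norm _).trans_eq (integral_congr_ae (.of_forall fun s => ?_))
    simp only [norm_smul, norm_chirp, conjReflect, RCLike.norm_conj]
  · filter_upwards [Measure.ae_ne volume (0 : V)] with u hu
    exact tendsto_zero_iff_norm_tendsto_zero.1 (tendsto_conjReflect_chirp_convolution_chirp b hu)

end Chirp

section Hat

variable {φ b : ℝ → ℂ}

theorem exists_schwartz_eq_hat (hφ : IsTestFunction φ) : ∃ S : 𝓢(ℝ, ℂ), ⇑S = hat φ := by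
  let Φ : 𝓢(ℝ, ℂ) := hφ.hasCompactSupport.toSchwartzMap hφ.contDiff
  let e : ℝ ≃L[ℝ] ℝ :=
    .unitsEquivAut ℝ (Units.mk0 (2 * Real.pi)⁻¹ (inv_ne_zero Real.two_pi_pos.ne'))
  refine ⟨SchwartzMap.compCLMOfContinuousLinearEquiv ℂ e (𝓕 Φ), funext fun w => ?_⟩
  simp [hat_eq_fourier, SchwartzMap.fourier_coe, e, Φ, div_eq_mul_inv]
  rfl

theorem memLp_hat (hφ : IsTestFunction φ) (p : ℝ≥0∞) : MemLp (hat φ) p := by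
  obtain ⟨S, hS⟩ := exists_schwartz_eq_hat hφ
  exact hS ▸ S.memLp p volume

theorem hat_neg_of_even (hφ : ∀ t, φ (-t) = φ t) (w : ℝ) : hat φ (-w) = hat φ w := by
  rw [hat, hat, ← integral_neg_eq_self]
  simp [hφ]

theorem integral_norm_sq_hat (hφ : IsTestFunction φ) :
    ∫ w, ‖hat φ w‖ ^ 2 = 2 * Real.pi * ∫ t, ‖φ t‖ ^ 2 := by
  have hparseval := SchwartzMap.integral_norm_sq_fourier
    (hφ.hasCompactSupport.toSchwartzMap hφ.contDiff)
  rw [SchwartzMap.fourier_coe] at hparseval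
  simp only [hat_eq_fourier]
  rw [Measure.integral_comp_div (fun ξ => ‖𝓕 φ ξ‖ ^ 2), abs_of_pos Real.two_pi_pos, smul_eq_mul]
  exact congrArg _ hparseval

theorem lintegral_enorm_sq_hat (hφ : IsTestFunction φ) :
    ∫⁻ w, ‖hat φ w‖ₑ ^ 2 = ENNReal.ofReal (2 * Real.pi * ∫ t, ‖φ t‖ ^ 2) := by
  have hint : Integrable (hat φ * hat φ) := (memLp_hat hφ 2).integrable_mul (memLp_hat hφ 2)
  rw [← integral_norm_sq_hat hφ]
  simpa [pow_two] using (ofReal_integral_norm_eq_lintegral_enorm hint).symm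

theorem eLpNorm_top_hat_le (hφ : Integrable φ) :
    eLpNorm (hat φ) ⊤ ≤ ENNReal.ofReal √(∫ u, ‖(conjReflect φ ⋆[lsmul ℂ ℂ] φ) u‖) := by
  rw [eLpNorm_exponent_top]
  refine eLpNormEssSup_le_of_ae_bound (.of_forall fun w => ?_)
  rw [hat_eq_fourier]
  exact Real.le_sqrt_of_sq_le (norm_sq_fourier_le hφ _)

theorem tendsto_eLpNorm_top_hat_chirp (hb : Integrable b) :
    Tendsto (fun r => eLpNorm (hat (chirp b r)) ⊤) atTop (𝓝 0) := by
  have hlim := ENNReal.tendsto_ofReal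
    (tendsto_integral_norm_conjReflect_chirp_convolution_chirp hb).sqrt
  rw [Real.sqrt_zero, ENNReal.ofReal_zero] at hlim
  exact tendsto_of_tendsto_of_tendsto_of_le_of_le tendsto_const_nhds hlim (fun _ => zero_le)
    fun r => eLpNorm_top_hat_le (integrable_chirp hb r)

variable {X : Type*} [NormedAddCommGroup X] [NormedSpace ℂ X]

theorem exists_norm_integral_hat_smul_le_of_fourierIsRegular {G : ℝ → X} (hG : FourierIsRegular G)
    (hb : Continuous b) (hbc : HasCompactSupport b) :
    ∃ C, ∀ φ, IsTestFunction φ → (∀ t, ‖φ t‖ ≤ ‖b t‖) → ‖∫ s, hat φ s • G s‖ ≤ C := by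
  obtain ⟨H, hH, hreg⟩ := hG
  refine ⟨∫ t, ‖b t • H t‖, fun φ hφ hφb => ?_⟩
  obtain ⟨φ, rfl⟩ := mem_testFns_iff.2 hφ
  rw [hreg]
  refine norm_integral_le_of_norm_le (hH.integrable_smul_left_of_hasCompactSupport hb hbc).norm
    (.of_forall fun t => ?_)
  rw [norm_smul, norm_smul]
  gcongr
  exact hφb t

theorem exists_memLp_not_fourierIsRegular [CompleteSpace X] [Nontrivial X] {J : Set ℝ}
    (hJ : MeasurableSet J) (hJ' : volume (J ∪ -J)ᶜ ≠ ⊤) {p : ℝ≥0∞} (hp : 2 < p) (hp_top : p ≠ ⊤) :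
    ∃ F : ℝ → X, MemLp F p (volume.restrict J) ∧ ¬ FourierIsRegular (J.indicator F) := by
  obtain ⟨x₀, hx₀⟩ := exists_ne (0 : X)
  let β : ContDiffBump (0 : ℝ) := default
  let b : ℝ → ℂ := fun t => β t
  have hb : IsTestFunction b := ⟨Complex.ofRealCLM.contDiff.comp β.contDiff,
    β.hasCompactSupport.comp_left Complex.ofReal_zero⟩
  have henergy : 0 < 2 * Real.pi * ∫ t, ‖b t‖ ^ 2 := by
    refine mul_pos Real.two_pi_pos (Continuous.integral_pos_of_hasCompactSupport_nonneg_nonzero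
      (x := 0) (hb.continuous.norm.pow 2) ?_ (fun t => by positivity) ?_)
    · exact hb.hasCompactSupport.norm.comp_left (g := (· ^ 2)) (zero_pow two_ne_zero)
    · simp [b, β.one_of_mem_closedBall (Metric.mem_closedBall_self β.rIn_pos.le)]
  obtain ⟨f, hf, hunbdd⟩ := exists_memLp_forall_exists_lt_norm_setIntegral_mul
    (S := fun r => hat (chirp b r)) hp hp_top
    (fun r => memLp_hat (isTestFunction_chirp hb r) _)
    (fun r => memLp_hat (isTestFunction_chirp hb r) _)
    (fun r => hat_neg_of_even fun t => by simp [chirp, b, β.neg])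
    (tendsto_eLpNorm_top_hat_chirp hb.integrable) (ENNReal.ofReal_pos.2 henergy).ne'
    ENNReal.ofReal_ne_top
    (fun r => by simp only [lintegral_enorm_sq_hat (isTestFunction_chirp hb r), norm_chirp]) hJ hJ'
  refine ⟨fun t => f t • x₀, (toSpanSingleton ℂ x₀).comp_memLp' hf, fun hreg => ?_⟩
  obtain ⟨C, hC⟩ := exists_norm_integral_hat_smul_le_of_fourierIsRegular hreg hb.continuous
    hb.hasCompactSupport
  obtain ⟨r, hr⟩ := hunbdd (C / ‖x₀‖)
  refine hr.not_ge ((le_div_iff₀ (norm_pos_iff.2 hx₀)).2 ?_)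
  rw [← norm_smul, ← integral_smul_const, ← integral_indicator hJ]
  simpa only [mul_smul, Set.indicator_smul] using
    hC (chirp b r) (isTestFunction_chirp hb r) fun t => (norm_chirp b r t).le

end Hat

end ReducedSpectrum

theorem corollary3p10_general {X : Type*} [NormedAddCommGroup X] [NormedSpace ℂ X] [CompleteSpace X]
    {J : Set ℝ} (hJ : IsClosed J) (hfr : Bornology.IsBounded (frontier J)) :
    (∀ F : ℝ → X, LocallyIntegrableOn F J volume →
      ReducedSpectrum.reducedSpectrum J (ReducedSpectrum.C0 J X) ReducedSpectrum.testFns F = ∅ →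
      ∀ ψ : ReducedSpectrum.TestFn,
        UniformContinuousOn (ReducedSpectrum.extConv J F ψ) J →
        ∃ g : C₀(ℝ, X), (g : ℝ → X) = ReducedSpectrum.extConv J F ψ) ∧
    (∀ (p : ℝ≥0∞) (F : ℝ → X), 1 ≤ p → p ≠ ∞ → MemLp F p (volume.restrict J) →
      LocallyIntegrableOn F J volume ∧
      ReducedSpectrum.reducedSpectrum J (ReducedSpectrum.C0 J X) ReducedSpectrum.testFns F = ∅ ∧
      ∀ ψ : ReducedSpectrum.TestFn, UniformContinuousOn (ReducedSpectrum.extConv J F ψ) J) ∧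
    (Nontrivial X → ¬ Bornology.IsBounded J → ∀ p : ℝ≥0∞, 2 < p → p ≠ ∞ →
      ∃ F : ℝ → X, MemLp F p (volume.restrict J) ∧
        ¬ ReducedSpectrum.FourierIsRegular (J.indicator F)) := by
  refine ⟨fun F hF hsp ψ hψ => ?_, fun p F hp hp_top hF => ⟨?_, ?_, fun ψ => ?_⟩,
    fun _ hJ' p hp hp_top => ?_⟩
  · exact ReducedSpectrum.exists_C0_eq_extConv hJ hfr hF hsp
      (ReducedSpectrum.mem_testFns_iff.1 ⟨ψ, rfl⟩) hψ
  · exact ReducedSpectrum.locallyIntegrableOn_of_memLp hp hF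
  · exact ReducedSpectrum.reducedSpectrum_eq_empty_of_memLp hJ hp hp_top hF
  · exact (ReducedSpectrum.uniformContinuous_extConv_of_memLp hJ hp hp_top hF
      (ReducedSpectrum.mem_testFns_iff.1 ⟨ψ, rfl⟩)).uniformContinuousOn
  · exact ReducedSpectrum.exists_memLp_not_fourierIsRegular hJ.measurableSet
      (ReducedSpectrum.isBounded_compl_union_neg hfr hJ').measure_lt_top.ne hp hp_top

theorem corollary3p10 {X : Type*} [NormedAddCommGroup X] [NormedSpace ℂ X] [CompleteSpace X]
    (J : Set ℝ) (hJ : J = Set.univ ∨ J = Set.Ici 0) :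
    (∀ F : ℝ → X, LocallyIntegrableOn F J volume →
      ReducedSpectrum.reducedSpectrum J (ReducedSpectrum.C0 J X) ReducedSpectrum.testFns F = ∅ →
      ∀ ψ : ReducedSpectrum.TestFn,
        UniformContinuousOn (ReducedSpectrum.extConv J F ψ) J →
        ∃ g : C₀(ℝ, X), (g : ℝ → X) = ReducedSpectrum.extConv J F ψ) ∧
    (∀ (p : ℝ≥0∞) (F : ℝ → X), 1 ≤ p → p ≠ ∞ → MemLp F p (volume.restrict J) →
      LocallyIntegrableOn F J volume ∧
      ReducedSpectrum.reducedSpectrum J (ReducedSpectrum.C0 J X) ReducedSpectrum.testFns F = ∅ ∧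
      ∀ ψ : ReducedSpectrum.TestFn, UniformContinuousOn (ReducedSpectrum.extConv J F ψ) J) ∧
    (Nontrivial X → ∀ p : ℝ≥0∞, 2 < p → p ≠ ∞ →
      ∃ F : ℝ → X, MemLp F p (volume.restrict J) ∧
        ¬ ReducedSpectrum.FourierIsRegular (J.indicator F)) := by
  obtain ⟨hcl, hfr, hunbdd⟩ :
      IsClosed J ∧ Bornology.IsBounded (frontier J) ∧ ¬ Bornology.IsBounded J := by
    rcases hJ with rfl | rfl
    · exact ⟨isClosed_univ, by simp, fun h => not_bddAbove_univ h.bddAbove⟩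
    · exact ⟨isClosed_Ici, by simp, fun h => not_bddAbove_Ici 0 h.bddAbove⟩
  exact (corollary3p10_general hcl hfr).imp_right <| .imp_right fun h hX => h hX hunbdd
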